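/- \textbf{Setting.} For a finite-dimensional Hilbert space $\mathcal H_X$ of dimension $d_X$, a state on $\mathcal H_X$ is a positive semidefinite operator of trace one; $\|A\|_1=\operatorname{Tr}\sqrt{AA^\dagger}$ is the trace norm and $\log$ is the logarithm to base $2$. Let $f$ be a real-valued function of states, given on the states of every system $X$ of some family of finite-dimensional systems (for instance on the states of $\mathbb C^d$ for all $d$). The function $f$ is \emph{subextensive} if there is a constant $M$ with $f(\varrho)\le M\log d_X$ for all systems $X$ and all states $\varrho$ on $\mathcal H_X$. It is \emph{asymptotically continuous} if there are a constant $K_1$ and a function $\eta$ with $\eta(t)\to 0$ as $t\downarrow 0$, both independent of the system, such that for all $X$ and all states $\varrho,\sigma$ on $\mathcal H_X$, with $\varepsilon=\|\varrho-\sigma\|_1$, $$|f(\varrho)-f(\sigma)|\le K_1\,\varepsilon\log d_X+\eta(\varepsilon).$$ The \emph{pure convex roof} of $f$ is $$\widehat f(\varrho)=\inf\Big\{\sum_k p_k\, f(|\psi_k\rangle\langle\psi_k|)\Big\},$$ the infimum being over all finite pure ensembles ($p_k\ge 0$, $\sum_k p_k=1$, $\psi_k$ unit vectors) with $\varrho=\sum_k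 p_k|\psi_k\rangle\langle\psi_k|$. \textbf{Proposition.} Let $f$ be subextensive and asymptotically continuous. Then the infimum defining $\widehat f(\varrho)$ is finite for every state $\varrho$, and $\widehat f$ is asymptotically continuous in the following sense: there are a constant $K$ and a function $\theta$ with $\theta(t)\to 0$ as $t\downarrow 0$, both independent of the system and in particular of its dimension, such that for all $X$ and all states $\varrho,\sigma$ on $\mathcal H_X$, with $\varepsilon=\|\varrho-\sigma\|_1$, $$|\widehat f(\varrho)-\widehat f(\sigma)|\le K\sqrt{2\varepsilon}\,\log d_X+\theta(\sqrt{2\varepsilon}).$$ -/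

import Mathlib

open Filter Topology
open scoped MatrixOrder ComplexOrder

noncomputable section

/-- The trace norm `‖A‖₁ = Tr √(A A†)`. -/
def traceNorm {n : Type*} [Fintype n] [DecidableEq n] (A : Matrix n n ℂ) : ℝ :=
  (CFC.sqrt (A * A.conjTranspose)).trace.re

/-- The states of the system with Hilbert space `ℂ^n`: positive operators of trace one. -/
def DensityMatrix (n : Type*) [Fintype n] : Type _ :=
  {ρ : Matrix n n ℂ // ρ.PosSemidef ∧ ρ.trace = 1}

/-- The unit vectors of `ℂ^n`, that is the vectors with `⟨ψ|ψ⟩ = 1`. -/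
def UnitVector (n : Type*) [Fintype n] : Type _ :=
  {ψ : n → ℂ // star ψ ⬝ᵥ ψ = 1}

/-- The pure state `|ψ⟩⟨ψ|`. -/
def pureState {n : Type*} [Fintype n] (ψ : UnitVector n) : DensityMatrix n :=
  ⟨Matrix.vecMulVec ψ.1 (star ψ.1), Matrix.posSemidef_vecMulVec_self_star ψ.1, by
    rw [Matrix.trace_vecMulVec, dotProduct_comm]; exact ψ.2⟩

/-- The trace distance `‖ρ - σ‖₁` (without a factor `1/2`). -/
def traceDist {n : Type*} [Fintype n] [DecidableEq n] (ρ σ : DensityMatrix n) : ℝ :=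
  traceNorm (ρ.1 - σ.1)

/-- The averages `∑ₖ pₖ f(ψₖ)` over all finite pure ensembles `{pₖ, ψₖ}` with
`ρ = ∑ₖ pₖ |ψₖ⟩⟨ψₖ|`. -/
def pureEnsembleAverages {n : Type*} [Fintype n] (f : DensityMatrix n → ℝ)
    (ρ : DensityMatrix n) : Set ℝ :=
  {x | ∃ (m : ℕ) (p : Fin m → ℝ) (ψ : Fin m → UnitVector n),
    (∀ k, 0 ≤ p k) ∧ ∑ k, p k = 1 ∧ ρ.1 = ∑ k, (p k : ℂ) • (pureState (ψ k)).1 ∧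
      x = ∑ k, p k * f (pureState (ψ k))}

/-- The pure convex roof of `f`. -/
def pureConvexRoof {n : Type*} [Fintype n] (f : DensityMatrix n → ℝ)
    (ρ : DensityMatrix n) : ℝ :=
  sInf (pureEnsembleAverages f ρ)

/-- Subextensivity of a function of states, given as a family `f i` over systems `ℂ^(X i)`:
`f(ρ) ≤ M log₂ d` with one constant `M` for all systems and all states. -/
def Subextensive {ι : Type*} {X : ι → Type*} [∀ i, Fintype (X i)]
    (f : ∀ i, DensityMatrix (X i) → ℝ) : Prop :=
  ∃ M : ℝ, ∀ (i : ι) (ρ : DensityMatrix (X i)),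
    f i ρ ≤ M * Real.logb 2 (Fintype.card (X i))

/-- Asymptotic continuity of a function of states, given as a family `f i` over systems
`ℂ^(X i)`: `|f(ρ) - f(σ)| ≤ K ε log₂ d + O(ε)` with `ε = ‖ρ - σ‖₁`, where the constant `K` and the
function `O`, which tends to `0` at `0`, are the same for all systems. -/
def AsymptoticallyContinuous {ι : Type*} {X : ι → Type*} [∀ i, Fintype (X i)]
    [∀ i, DecidableEq (X i)] (f : ∀ i, DensityMatrix (X i) → ℝ) : Prop :=
  ∃ (K : ℝ) (O : ℝ → ℝ), Tendsto O (𝓝[>] 0) (𝓝 0) ∧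
    ∀ (i : ι) (ρ σ : DensityMatrix (X i)),
      |f i ρ - f i σ| ≤
        K * traceDist ρ σ * Real.logb 2 (Fintype.card (X i)) + O (traceDist ρ σ)

end

/-! ### Trace norm, Powers–Størmer, and trace distance of pure states. -/

section TraceNorm

variable {n : Type*} [Fintype n] [DecidableEq n]

/-! Any pure ensemble of `ρ` can be moved to one of `σ` at a cost of order `√ε`. Its weighted
vectors are the columns of some `A` with `A A† = ρ`; padded by zero columns, `A = √ρ V` with `V V† =
1`. Then `√σ V` factors `σ`, and by `powers_stormer` its columns are within `ε` in total squared
distance. Cauchy–Schwarz turns this into `√ε` bounds on the average trace distance and on the change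
of weights (`exists_ensemble_near`).

The error function of `f` cannot be averaged over the ensemble, as it need not be concave, or
bounded away from `0`. Cutting segments of states into steps of length at most `δ` replaces it by an
affine modulus (`abs_sub_le_of_small_steps`), which averages exactly. This also bounds the
oscillation of `f` on pure states, which controls the change of weights. Taking `δ` of order `√ε`
keeps the number of steps bounded on average. -/

lemma traceNorm_eq_abs {A : Matrix n n ℂ} (hA : A.IsHermitian) :
    traceNorm A = (CFC.abs A).trace.re := by
  rw [traceNorm, CFC.abs, Matrix.star_eq_conjTranspose, hA.eq]

lemma traceNorm_neg (A : Matrix n n ℂ) : traceNorm (-A) = traceNorm A := by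
  simp [traceNorm]

lemma traceNorm_nonneg (A : Matrix n n ℂ) : 0 ≤ traceNorm A :=
  (Complex.le_def.1 (Matrix.nonneg_iff_posSemidef.1
    (CFC.sqrt_nonneg (A * A.conjTranspose))).trace_nonneg).1

lemma traceNorm_smul {c : ℝ} (hc : 0 ≤ c) (A : Matrix n n ℂ) :
    traceNorm ((c : ℂ) • A) = c * traceNorm A := by
  have h0 : (0 : ℂ) ≤ c := by exact_mod_cast hc
  have hA : 0 ≤ A * A.conjTranspose := (Matrix.posSemidef_self_mul_conjTranspose A).nonneg
  have : CFC.sqrt (((c : ℂ) • A) * ((c : ℂ) • A).conjTranspose) =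
      (c : ℂ) • CFC.sqrt (A * A.conjTranspose) := by
    refine CFC.sqrt_unique ?_ ?_
    · rw [smul_mul_smul_comm, CFC.sqrt_mul_sqrt_self _ hA, Matrix.conjTranspose_smul,
        smul_mul_smul_comm]
      simp
    · exact ((Matrix.nonneg_iff_posSemidef.1 (CFC.sqrt_nonneg (A * A.conjTranspose))).smul h0).nonneg
  rw [traceNorm, this, Matrix.trace_smul, smul_eq_mul, Complex.re_ofReal_mul, traceNorm]

lemma eq_zero_of_traceNorm_eq_zero {A : Matrix n n ℂ} (h : traceNorm A = 0) : A = 0 := by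
  have hA : 0 ≤ A * A.conjTranspose := (Matrix.posSemidef_self_mul_conjTranspose A).nonneg
  have hS := (Matrix.nonneg_iff_posSemidef.1 (CFC.sqrt_nonneg (A * A.conjTranspose)))
  have ht : (CFC.sqrt (A * A.conjTranspose)).trace = 0 :=
    Complex.ext h (Complex.le_def.1 hS.trace_nonneg).2.symm
  rw [hS.trace_eq_zero_iff, CFC.sqrt_eq_zero_iff _ hA] at ht
  exact Matrix.self_mul_conjTranspose_eq_zero.1 ht

lemma Matrix.PosSemidef.re_trace_mul_nonneg {A B : Matrix n n ℂ} (hA : A.PosSemidef)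
    (hB : B.PosSemidef) : 0 ≤ (A * B).trace.re := by
  obtain ⟨C, rfl⟩ := CStarAlgebra.nonneg_iff_eq_star_mul_self.mp hB.nonneg
  rw [← mul_assoc, Matrix.trace_mul_comm, ← mul_assoc, Matrix.star_eq_conjTranspose]
  exact (Complex.le_def.1 (hA.mul_mul_conjTranspose_same C).trace_nonneg).1

lemma re_trace_mul_le_traceNorm {U A : Matrix n n ℂ} (hA : A.IsHermitian) (h1 : U ≤ 1)
    (h2 : -1 ≤ U) : (U * A).trace.re ≤ traceNorm A := by
  have hs : IsSelfAdjoint A := hA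
  have e1 := Matrix.PosSemidef.re_trace_mul_nonneg (Matrix.le_iff.1 h1)
    (Matrix.nonneg_iff_posSemidef.1 (CFC.posPart_nonneg A))
  have e2 := Matrix.PosSemidef.re_trace_mul_nonneg (Matrix.le_iff.1 h2)
    (Matrix.nonneg_iff_posSemidef.1 (CFC.negPart_nonneg A))
  rw [traceNorm_eq_abs hA, ← CFC.posPart_add_negPart A hs]
  conv_lhs => rw [← CFC.posPart_sub_negPart A hs]
  simp only [sub_mul, add_mul, mul_sub, one_mul, Matrix.trace_sub,
    Matrix.trace_add, sub_neg_eq_add, Complex.sub_re, Complex.add_re] at *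
  linarith

/-- The sign `U` of a Hermitian matrix `A`: a Hermitian contraction with `U A = A U = |A|`. -/
lemma exists_sign {A : Matrix n n ℂ} (hA : A.IsHermitian) :
    ∃ U : Matrix n n ℂ, U.IsHermitian ∧ U ≤ 1 ∧ -1 ≤ U ∧ (1 - U * U).PosSemidef ∧
      U * A = CFC.abs A ∧ A * U = CFC.abs A := by
  have hs : IsSelfAdjoint A := hA
  have hc : ∀ g : ℝ → ℝ, ContinuousOn g (spectrum ℝ A) := fun g =>
    (Matrix.finite_real_spectrum (A := A)).continuousOn g
  let s : ℝ → ℝ := fun x => SignType.sign x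
  have hsle : ∀ x, s x ≤ 1 := fun x => by
    rcases lt_trichotomy x 0 with h | h | h <;> simp [s, h]
  have hsge : ∀ x, -1 ≤ s x := fun x => by
    rcases lt_trichotomy x 0 with h | h | h <;> simp [s, h]
  have habs : CFC.abs A = cfc (fun x : ℝ => |x|) A := by
    rw [CFC.abs_eq_cfc_norm A hs]; rfl
  have hid : A = cfc (fun x : ℝ => x) A := (cfc_id' ℝ A hs).symm
  refine ⟨cfc s A, cfc_predicate s A, cfc_le_one _ _ fun x _ => hsle x, ?_, ?_, ?_, ?_⟩
  · have := algebraMap_le_cfc s (-1) A (fun x _ => hsge x) (hc _) hs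
    simpa using this
  · rw [← cfc_mul s s A (hc _) (hc _), ← Matrix.le_iff]
    exact cfc_le_one _ _ fun x _ => by nlinarith [hsle x, hsge x]
  · rw [habs]
    nth_rw 2 [hid]
    rw [← cfc_mul s _ A (hc _) (hc _)]
    exact cfc_congr fun x _ => sign_mul_self x
  · rw [habs]
    nth_rw 1 [hid]
    rw [← cfc_mul _ s A (hc _) (hc _)]
    exact cfc_congr fun x _ => self_mul_sign x

/-- The Powers–Størmer inequality. -/
lemma powers_stormer {X Y : Matrix n n ℂ} (hX : X.PosSemidef) (hY : Y.PosSemidef) :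
    ((X - Y) * (X - Y)).trace.re ≤ traceNorm (X * X - Y * Y) := by
  have hD : (X - Y).IsHermitian := hX.1.sub hY.1
  have hs : IsSelfAdjoint (X - Y) := hD
  obtain ⟨U, -, hU1, hU2, -, hUD, hDU⟩ := exists_sign hD
  have hH : (X * X - Y * Y).IsHermitian := by
    rw [Matrix.IsHermitian, Matrix.conjTranspose_sub, Matrix.conjTranspose_mul,
      Matrix.conjTranspose_mul, hX.1.eq, hY.1.eq]
  refine le_trans ?_ (re_trace_mul_le_traceNorm hH hU1 hU2)
  -- With `D = X - Y` and `S = X + Y`, `2(X² - Y²) = D S + S D`; both terms have the same trace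
  -- against `U`, since `U D = D U = |D|`.
  have e0 : (U * (X * X - Y * Y)).trace = (CFC.abs (X - Y) * (X + Y)).trace := by
    have a1 : U * (X * X - Y * Y) + U * (X * X - Y * Y) =
        U * (X - Y) * (X + Y) + U * ((X + Y) * (X - Y)) := by noncomm_ring
    have a2 : (U * ((X + Y) * (X - Y))).trace = (CFC.abs (X - Y) * (X + Y)).trace := by
      rw [← hDU, Matrix.trace_mul_comm, mul_assoc, Matrix.trace_mul_comm, mul_assoc]
    have a3 := congrArg Matrix.trace a1
    rw [Matrix.trace_add, Matrix.trace_add, a2, hUD, ← two_mul, ← two_mul] at a3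
    exact mul_left_cancel₀ two_ne_zero a3
  rw [e0]
  have p1 := Matrix.PosSemidef.re_trace_mul_nonneg (Matrix.nonneg_iff_posSemidef.1 (CFC.posPart_nonneg (X - Y))) hY
  have p2 := Matrix.PosSemidef.re_trace_mul_nonneg (Matrix.nonneg_iff_posSemidef.1 (CFC.negPart_nonneg (X - Y))) hX
  -- The excess over `D²` is `2(D⁺ Y + D⁻ X)`, whose trace is nonnegative.
  have key : CFC.abs (X - Y) * (X + Y) = (X - Y) * (X - Y) +
      ((X - Y)⁺ * Y + (X - Y)⁺ * Y) + ((X - Y)⁻ * X + (X - Y)⁻ * X) := by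
    rw [← CFC.posPart_add_negPart _ hs]
    have h2 : (X - Y) * (X - Y) = ((X - Y)⁺ - (X - Y)⁻) * (X - Y) := by
      rw [CFC.posPart_sub_negPart _ hs]
    rw [h2]
    generalize (X - Y)⁺ = P
    generalize (X - Y)⁻ = Q
    noncomm_ring
  rw [key]
  simp only [Matrix.trace_add, Complex.add_re]
  linarith

lemma norm_toLp_mulVec_le {U : Matrix n n ℂ} (hU : U.IsHermitian)
    (h : (1 - U * U).PosSemidef) (v : n → ℂ) :
    ‖(WithLp.toLp 2 (U.mulVec v) : EuclideanSpace ℂ n)‖ ≤ ‖WithLp.toLp 2 v‖ := by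
  have := (Complex.le_def.1 (h.dotProduct_mulVec_nonneg v)).1
  rw [Matrix.sub_mulVec, Matrix.one_mulVec, dotProduct_sub, ← Matrix.mulVec_mulVec,
    Matrix.dotProduct_mulVec, ← hU.eq, ← Matrix.star_mulVec, hU.eq, Complex.sub_re] at this
  refine le_of_sq_le_sq ?_ (norm_nonneg _)
  rw [← inner_self_eq_norm_sq (𝕜 := ℂ), ← inner_self_eq_norm_sq (𝕜 := ℂ),
    EuclideanSpace.inner_eq_star_dotProduct, EuclideanSpace.inner_eq_star_dotProduct,
    dotProduct_comm, dotProduct_comm v]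
  simpa using this

omit [DecidableEq n] in
lemma UnitVector.norm_eq_one (ψ : UnitVector n) :
    ‖(WithLp.toLp 2 ψ.1 : EuclideanSpace ℂ n)‖ = 1 := by
  rw [← sq_eq_sq₀ (norm_nonneg _) zero_le_one, ← inner_self_eq_norm_sq (𝕜 := ℂ),
    EuclideanSpace.inner_eq_star_dotProduct, dotProduct_comm]
  simp [ψ.2]

/-- With `U` the sign of the difference, the trace norm is `⟨ψ, U(ψ - φ)⟩ + ⟨ψ - φ, Uφ⟩`;
Cauchy–Schwarz bounds each term, as `U` is a contraction. -/
lemma traceDist_pureState_le (ψ φ : UnitVector n) :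
    traceDist (pureState ψ) (pureState φ) ≤
      2 * ‖(WithLp.toLp 2 (ψ.1 - φ.1) : EuclideanSpace ℂ n)‖ := by
  have hH : ((pureState ψ).1 - (pureState φ).1).IsHermitian :=
    (pureState ψ).2.1.1.sub (pureState φ).2.1.1
  obtain ⟨U, hU, -, -, hUU, hUD, -⟩ := exists_sign hH
  rw [traceDist, traceNorm_eq_abs hH, ← hUD]
  have e : (U * ((pureState ψ).1 - (pureState φ).1)).trace =
      star ψ.1 ⬝ᵥ U.mulVec (ψ.1 - φ.1) + star (ψ.1 - φ.1) ⬝ᵥ U.mulVec φ.1 := by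
    simp only [pureState, mul_sub, Matrix.trace_sub, Matrix.mul_vecMulVec, Matrix.trace_vecMulVec,
      Matrix.mulVec_sub, dotProduct_sub, star_sub, sub_dotProduct]
    rw [dotProduct_comm _ (star ψ.1), dotProduct_comm _ (star φ.1)]
    ring
  have cs : ∀ x y : n → ℂ, (star x ⬝ᵥ y).re ≤
      ‖(WithLp.toLp 2 x : EuclideanSpace ℂ n)‖ * ‖(WithLp.toLp 2 y : EuclideanSpace ℂ n)‖ := by
    intro x y
    have := re_inner_le_norm (𝕜 := ℂ) (WithLp.toLp 2 x : EuclideanSpace ℂ n) (WithLp.toLp 2 y)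
    rwa [EuclideanSpace.inner_eq_star_dotProduct, dotProduct_comm] at this
  rw [e, Complex.add_re]
  have h1 := cs ψ.1 (U.mulVec (ψ.1 - φ.1))
  have h2 := cs (ψ.1 - φ.1) (U.mulVec φ.1)
  have h3 := norm_toLp_mulVec_le hU hUU (ψ.1 - φ.1)
  have h4 := norm_toLp_mulVec_le hU hUU φ.1
  rw [ψ.norm_eq_one] at h1
  rw [φ.norm_eq_one] at h4
  nlinarith [norm_nonneg (WithLp.toLp 2 (ψ.1 - φ.1) : EuclideanSpace ℂ n)]

end TraceNorm

/-! ### Pure ensembles as factorizations, and their transport between states. -/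

section Ensembles

variable {n : Type*} [Fintype n]

lemma mem_pureEnsembleAverages {κ : Type*} [Fintype κ] (f : DensityMatrix n → ℝ)
    {ρ : DensityMatrix n} {p : κ → ℝ} {ψ : κ → UnitVector n} (hp : ∀ k, 0 ≤ p k)
    (hp1 : ∑ k, p k = 1) (hρ : ρ.1 = ∑ k, (p k : ℂ) • (pureState (ψ k)).1) :
    ∑ k, p k * f (pureState (ψ k)) ∈ pureEnsembleAverages f ρ := by
  let e := (Fintype.equivFin κ).symm
  refine ⟨Fintype.card κ, p ∘ e, ψ ∘ e, fun k => hp _, ?_, ?_, ?_⟩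
  · rw [← hp1]; exact e.sum_comp p
  · rw [hρ]; exact (e.sum_comp fun k => (p k : ℂ) • (pureState (ψ k)).1).symm
  · exact (e.sum_comp fun k => p k * f (pureState (ψ k))).symm

lemma exists_eq_norm_smul_unitVector (ψ : UnitVector n) (b : n → ℂ) :
    ∃ φ : UnitVector n, b = ((‖(WithLp.toLp 2 b : EuclideanSpace ℂ n)‖ : ℝ) : ℂ) • φ.1 := by
  by_cases hb : (WithLp.toLp 2 b : EuclideanSpace ℂ n) = 0
  · refine ⟨ψ, ?_⟩
    rw [hb, norm_zero, Complex.ofReal_zero, zero_smul]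
    exact congrArg WithLp.ofLp hb
  · have hn : ((‖(WithLp.toLp 2 b : EuclideanSpace ℂ n)‖ : ℝ) : ℂ) ≠ 0 := by
      exact_mod_cast norm_ne_zero_iff.2 hb
    refine ⟨⟨((‖(WithLp.toLp 2 b : EuclideanSpace ℂ n)‖ : ℝ) : ℂ)⁻¹ • b, ?_⟩, ?_⟩
    · have h := inner_self_eq_norm_sq_to_K (𝕜 := ℂ) (WithLp.toLp 2 b : EuclideanSpace ℂ n)
      rw [EuclideanSpace.inner_eq_star_dotProduct, dotProduct_comm] at h
      change star b ⬝ᵥ b = _ at h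
      rw [star_smul, smul_dotProduct, dotProduct_smul, h]
      simp only [star_inv₀, Complex.star_def, Complex.conj_ofReal, smul_eq_mul]
      change _ * (_ * ((‖(WithLp.toLp 2 b : EuclideanSpace ℂ n)‖ : ℝ) : ℂ) ^ 2) = 1
      field_simp
    · simp [smul_smul, hn]

lemma trace_sum_smul_pureState {κ : Type*} [Fintype κ] (p : κ → ℝ) (ψ : κ → UnitVector n) :
    (∑ k, (p k : ℂ) • (pureState (ψ k)).1).trace = ∑ k, p k := by
  simp [Matrix.trace_sum, Matrix.trace_smul, (pureState _).2.2]

lemma smul_pureState (s : ℝ) (φ : UnitVector n) :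
    ((s ^ 2 : ℝ) : ℂ) • (pureState φ).1 =
      Matrix.vecMulVec ((s : ℂ) • φ.1) (star ((s : ℂ) • φ.1)) := by
  rw [star_smul, Matrix.vecMulVec_smul, Matrix.smul_vecMulVec, smul_smul, pureState]
  simp [sq]

omit [Fintype n] in
lemma mul_conjTranspose_eq_sum {κ : Type*} [Fintype κ] (B : Matrix n κ ℂ) :
    B * B.conjTranspose = ∑ k, Matrix.vecMulVec (B.col k) (star (B.col k)) := by
  ext i j
  simp [Matrix.mul_apply, Matrix.sum_apply, Matrix.vecMulVec_apply]

lemma re_trace_mul_conjTranspose {κ : Type*} [Fintype κ] (B : Matrix n κ ℂ) :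
    (B * B.conjTranspose).trace.re =
      ∑ k, ‖(WithLp.toLp 2 (B.col k) : EuclideanSpace ℂ n)‖ ^ 2 := by
  rw [mul_conjTranspose_eq_sum, Matrix.trace_sum, Complex.re_sum]
  refine Finset.sum_congr rfl fun k _ => ?_
  rw [← inner_self_eq_norm_sq (𝕜 := ℂ), EuclideanSpace.inner_eq_star_dotProduct,
    Matrix.trace_vecMulVec]
  rfl

variable [DecidableEq n]

/-- A factorization `ρ = A A†` is followed by a nearby factorization of `σ`. -/
lemma exists_factorization_near {κ : Type*} [Fintype κ] {ρ σ : Matrix n n ℂ}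
    (hρ : ρ.PosSemidef) (hσ : σ.PosSemidef) {A : Matrix n κ ℂ} (hA : A * A.conjTranspose = ρ) :
    ∃ B : Matrix n (κ ⊕ n) ℂ, B * B.conjTranspose = σ ∧
      ((Matrix.fromCols A 0 - B) * (Matrix.fromCols A 0 - B).conjTranspose).trace.re ≤
        traceNorm (ρ - σ) := by
  have hs : IsSelfAdjoint ρ := hρ.1
  have hc : ∀ g : ℝ → ℝ, ContinuousOn g (spectrum ℝ ρ) := fun g =>
    (Matrix.finite_real_spectrum (A := ρ)).continuousOn g
  have hspec : ∀ x ∈ spectrum ℝ ρ, 0 ≤ x := fun x hx =>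
    spectrum_nonneg_of_nonneg hρ.nonneg hx
  have hH : ∀ g : ℝ → ℝ, (cfc g ρ).IsHermitian := fun g => cfc_predicate g ρ
  -- `P` is the support projection of `ρ`, `S` its square root, and `R` the pseudo-inverse of `S`,
  -- thanks to `0⁻¹ = 0`.
  let P := cfc (fun x : ℝ => if x = 0 then (0 : ℝ) else 1) ρ
  let R := cfc (fun x : ℝ => (√x)⁻¹) ρ
  let S := cfc (fun x : ℝ => √x) ρ
  let T := CFC.sqrt σ
  have hid : cfc (fun x : ℝ => x) ρ = ρ := cfc_id' ℝ ρ hs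
  have hPh : P.conjTranspose = P := hH _
  have hRh : R.conjTranspose = R := hH _
  have hSh : S.conjTranspose = S := hH _
  have hT0 : T.PosSemidef := Matrix.nonneg_iff_posSemidef.1 (CFC.sqrt_nonneg σ)
  have hTT : T * T = σ := CFC.sqrt_mul_sqrt_self σ hσ.nonneg
  have hS0 : S.PosSemidef :=
    Matrix.nonneg_iff_posSemidef.1 (cfc_nonneg fun x _ => Real.sqrt_nonneg x)
  have hSS : S * S = ρ := by
    rw [← cfc_mul _ _ ρ (hc _) (hc _)]
    conv_rhs => rw [← hid]
    exact cfc_congr fun x hx => Real.mul_self_sqrt (hspec x hx)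
  have hPP : P * P = P := by
    rw [← cfc_mul _ _ ρ (hc _) (hc _)]
    exact cfc_congr fun x hx => by by_cases h : x = 0 <;> simp [h]
  have hPρ : P * ρ = ρ := by
    conv_lhs => rw [← hid]
    conv_rhs => rw [← hid]
    rw [← cfc_mul _ _ ρ (hc _) (hc _)]
    exact cfc_congr fun x hx => by by_cases h : x = 0 <;> simp [h]
  have hSR : S * R = P := by
    rw [← cfc_mul _ _ ρ (hc _) (hc _)]
    refine cfc_congr fun x hx => ?_
    by_cases h : x = 0
    · simp [h]
    · have := (Real.sqrt_pos.2 (lt_of_le_of_ne (hspec x hx) (Ne.symm h))).ne'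
      simp [h, this]
  have hRρR : R * ρ * R = P := by
    conv_lhs => rw [← hid]
    rw [← cfc_mul _ _ ρ (hc _) (hc _), ← cfc_mul _ _ ρ (hc _) (hc _)]
    refine cfc_congr fun x hx => ?_
    by_cases h : x = 0
    · simp [h]
    · have := (Real.sqrt_pos.2 (lt_of_le_of_ne (hspec x hx) (Ne.symm h))).ne'
      have h2 := Real.mul_self_sqrt (hspec x hx)
      simp only [h, if_false]
      field_simp
      nlinarith
  have hSP : S * P = S := by
    rw [← cfc_mul _ _ ρ (hc _) (hc _)]
    exact cfc_congr fun x hx => by by_cases h : x = 0 <;> simp [h]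
  have hPA : P * A = A := by
    have h0 : ((1 - P) * A) * ((1 - P) * A).conjTranspose = 0 := by
      rw [Matrix.conjTranspose_mul, Matrix.mul_assoc, ← Matrix.mul_assoc A, hA,
        ← Matrix.mul_assoc, sub_mul, hPρ]
      simp
    rw [Matrix.self_mul_conjTranspose_eq_zero, Matrix.sub_mul, Matrix.one_mul, sub_eq_zero] at h0
    exact h0.symm
  -- `R A` is coisometric only onto the support of `ρ`; the block `1 - P` supplies the kernel and is
  -- killed by `S`.
  let V : Matrix n (κ ⊕ n) ℂ := Matrix.fromCols (R * A) (1 - P)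
  have hVV : V * V.conjTranspose = 1 := by
    rw [Matrix.conjTranspose_fromCols_eq_fromRows_conjTranspose, Matrix.fromCols_mul_fromRows,
      Matrix.conjTranspose_mul, Matrix.conjTranspose_sub, hRh, hPh, Matrix.conjTranspose_one,
      Matrix.mul_assoc, ← Matrix.mul_assoc A, hA, ← Matrix.mul_assoc, hRρR]
    have : (1 - P) * (1 - P) = 1 - P - P + P * P := by noncomm_ring
    rw [this, hPP]
    abel
  have hSV : Matrix.fromCols A 0 = S * V := by
    rw [Matrix.mul_fromCols, ← Matrix.mul_assoc, hSR, hPA, mul_sub, mul_one, hSP, sub_self]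
  refine ⟨T * V, ?_, ?_⟩
  · rw [Matrix.conjTranspose_mul, Matrix.mul_assoc, ← Matrix.mul_assoc V, hVV, Matrix.one_mul,
      hT0.1.eq, hTT]
  · rw [hSV, ← Matrix.sub_mul, Matrix.conjTranspose_mul, Matrix.mul_assoc, ← Matrix.mul_assoc V, hVV,
      Matrix.one_mul, Matrix.conjTranspose_sub, hSh, hT0.1.eq, ← hSS, ← hTT]
    exact powers_stormer hS0 hT0

lemma sum_mul_le_of_sum_sq_le {κ : Type*} [Fintype κ] {a b : κ → ℝ} {s t : ℝ}
    (ha : ∑ k, a k ^ 2 ≤ s) (hb : ∑ k, b k ^ 2 ≤ t) : ∑ k, a k * b k ≤ √s * √t :=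
  (Real.sum_mul_le_sqrt_mul_sqrt _ a b).trans
    (mul_le_mul (Real.sqrt_le_sqrt ha) (Real.sqrt_le_sqrt hb) (Real.sqrt_nonneg _)
      (Real.sqrt_nonneg _))

/-- Every pure ensemble of `ρ` (padded by weights zero) is close to a pure ensemble of `σ`. -/
lemma exists_ensemble_near {ρ σ : DensityMatrix n} {m : ℕ} {p : Fin m → ℝ}
    {ψ : Fin m → UnitVector n} (hp : ∀ k, 0 ≤ p k) (hp1 : ∑ k, p k = 1)
    (hρ : ρ.1 = ∑ k, (p k : ℂ) • (pureState (ψ k)).1) :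
    ∃ (p' q : Fin m ⊕ n → ℝ) (ψ' φ : Fin m ⊕ n → UnitVector n),
      (∀ k, 0 ≤ p' k) ∧ (∀ k, 0 ≤ q k) ∧ ∑ k, p' k = 1 ∧ ∑ k, q k = 1 ∧
      (∀ g : UnitVector n → ℝ, ∑ k, p' k * g (ψ' k) = ∑ k, p k * g (ψ k)) ∧
      σ.1 = ∑ k, (q k : ℂ) • (pureState (φ k)).1 ∧
      ∑ k, p' k * traceDist (pureState (ψ' k)) (pureState (φ k)) ≤ 4 * √(traceDist ρ σ) ∧
      ∑ k, |q k - p' k| ≤ 2 * √(traceDist ρ σ) := by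
  have hm : Nonempty (Fin m) := by
    by_contra h
    rw [not_nonempty_iff] at h
    simp at hp1
  obtain ⟨k₀⟩ := hm
  let A : Matrix n (Fin m) ℂ := Matrix.of fun i k => ((√(p k) : ℝ) : ℂ) * (ψ k).1 i
  have hAcol : ∀ k, A.col k = ((√(p k) : ℝ) : ℂ) • (ψ k).1 := fun k => rfl
  have hA : A * A.conjTranspose = ρ.1 := by
    rw [mul_conjTranspose_eq_sum, hρ]
    refine Finset.sum_congr rfl fun k _ => ?_
    rw [hAcol, ← smul_pureState, Real.sq_sqrt (hp k)]
  obtain ⟨B, hB, hAB⟩ := exists_factorization_near ρ.2.1 σ.2.1 hA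
  choose φ hφ using fun k => exists_eq_norm_smul_unitVector (ψ k₀) (B.col k)
  let s : Fin m ⊕ n → ℝ := fun k => ‖(WithLp.toLp 2 (B.col k) : EuclideanSpace ℂ n)‖
  let r : Fin m ⊕ n → ℝ := Sum.elim (fun k => √(p k)) fun _ => 0
  let ψ' : Fin m ⊕ n → UnitVector n := Sum.elim ψ fun _ => ψ k₀
  have hr0 : ∀ k, 0 ≤ r k := by rintro (k | k) <;> simp [r]
  have hs0 : ∀ k, 0 ≤ s k := fun k => norm_nonneg _
  have hsum : ∀ g : UnitVector n → ℝ, ∑ k, r k ^ 2 * g (ψ' k) = ∑ k, p k * g (ψ k) := by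
    intro g
    simp [r, ψ', Fintype.sum_sum_type, Real.sq_sqrt (hp _)]
  have hr1 : ∑ k, r k ^ 2 = 1 := by simpa [hp1] using hsum fun _ => 1
  have hσ : σ.1 = ∑ k, ((s k ^ 2 : ℝ) : ℂ) • (pureState (φ k)).1 := by
    rw [← hB, mul_conjTranspose_eq_sum]
    refine Finset.sum_congr rfl fun k _ => ?_
    rw [smul_pureState, ← hφ k]
  have hs1 : ∑ k, s k ^ 2 = 1 := by
    have := trace_sum_smul_pureState (fun k => s k ^ 2) φ
    rw [← hσ, σ.2.2] at this
    exact_mod_cast this.symm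
  let x : Fin m ⊕ n → EuclideanSpace ℂ n := fun k => WithLp.toLp 2 (ψ' k).1
  let y : Fin m ⊕ n → EuclideanSpace ℂ n := fun k => WithLp.toLp 2 (φ k).1
  have hx : ∀ k, ‖x k‖ = 1 := fun k => (ψ' k).norm_eq_one
  have hy : ∀ k, ‖y k‖ = 1 := fun k => (φ k).norm_eq_one
  let d : Fin m ⊕ n → ℝ := fun k => ‖(r k : ℂ) • x k - (s k : ℂ) • y k‖
  have hd : ∑ k, d k ^ 2 ≤ traceDist ρ σ := by
    refine le_trans (le_of_eq ?_) hAB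
    rw [re_trace_mul_conjTranspose]
    refine Finset.sum_congr rfl fun k _ => ?_
    have h1 : (Matrix.fromCols A 0 - B).col k = (r k : ℂ) • (ψ' k).1 - (s k : ℂ) • (φ k).1 := by
      have h2 : (Matrix.fromCols A (0 : Matrix n n ℂ)).col k = (r k : ℂ) • (ψ' k).1 := by
        rcases k with k | k
        · exact hAcol k
        · simp only [r, Sum.elim_inr, Complex.ofReal_zero, zero_smul]
          rfl
      rw [← h2, ← hφ k]
      rfl
    rw [h1]
    rfl
  have hrs : ∀ k, |s k - r k| ≤ d k := by
    intro k
    have := abs_norm_sub_norm_le ((r k : ℂ) • x k) ((s k : ℂ) • y k)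
    rw [norm_smul, norm_smul, hx, hy] at this
    simp only [Complex.norm_real, Real.norm_eq_abs, abs_of_nonneg (hr0 k),
      abs_of_nonneg (hs0 k), mul_one] at this
    rwa [abs_sub_comm]
  -- One `d k` for the vectors, one for replacing `r k` by `s k`.
  have hrd : ∀ k, r k * ‖x k - y k‖ ≤ 2 * d k := by
    intro k
    have h1 : r k * ‖x k - y k‖ = ‖((r k : ℂ) • x k - (s k : ℂ) • y k) +
        ((s k : ℂ) - (r k : ℂ)) • y k‖ := by
      rw [show ((r k : ℂ) • x k - (s k : ℂ) • y k) + ((s k : ℂ) - (r k : ℂ)) • y k =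
        (r k : ℂ) • (x k - y k) by module, norm_smul, Complex.norm_real, Real.norm_eq_abs,
        abs_of_nonneg (hr0 k)]
    have h2 : ‖((s k : ℂ) - (r k : ℂ)) • y k‖ = |s k - r k| := by
      rw [norm_smul, hy, mul_one, ← Complex.ofReal_sub, Complex.norm_real, Real.norm_eq_abs]
    rw [h1]
    refine (norm_add_le _ _).trans ?_
    rw [h2]
    linarith [hrs k]
  refine ⟨fun k => r k ^ 2, fun k => s k ^ 2, ψ', φ, fun k => sq_nonneg _, fun k => sq_nonneg _,
    hr1, hs1, hsum, hσ, ?_, ?_⟩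
  -- The weight is `r²`: one factor `r` goes into `hrd`, the other into Cauchy–Schwarz. The 4 is 2
  -- from `hrd` times 2 from `traceDist_pureState_le`.
  · have cs := sum_mul_le_of_sum_sq_le hr1.le hd
    rw [Real.sqrt_one, one_mul] at cs
    refine le_trans ?_ (mul_le_mul_of_nonneg_left cs (by norm_num : (0 : ℝ) ≤ 4))
    rw [Finset.mul_sum]
    refine Finset.sum_le_sum fun k _ => ?_
    have h1 := traceDist_pureState_le (ψ' k) (φ k)
    change _ ≤ 2 * ‖x k - y k‖ at h1
    have h2 := mul_le_mul_of_nonneg_left h1 (sq_nonneg (r k))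
    have h3 := mul_le_mul_of_nonneg_left (hrd k) (hr0 k)
    nlinarith
  · have h2 : ∑ k, (s k + r k) ^ 2 ≤ 4 := by
      calc ∑ k, (s k + r k) ^ 2 ≤ ∑ k, (2 * s k ^ 2 + 2 * r k ^ 2) :=
            Finset.sum_le_sum fun k _ => by nlinarith [sq_nonneg (s k - r k)]
        _ = 4 := by
            rw [Finset.sum_add_distrib, ← Finset.mul_sum, ← Finset.mul_sum, hs1, hr1]
            norm_num
    have cs := sum_mul_le_of_sum_sq_le h2 hd
    rw [show (4 : ℝ) = 2 ^ 2 by norm_num, Real.sqrt_sq zero_le_two] at cs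
    refine le_trans (Finset.sum_le_sum fun k _ => ?_) cs
    rw [sq_sub_sq, abs_mul, abs_of_nonneg (add_nonneg (hs0 k) (hr0 k))]
    exact mul_le_mul_of_nonneg_left (hrs k) (add_nonneg (hs0 k) (hr0 k))

/-- The one-term ensemble of a basis state is transported to `ρ`. -/
lemma pureEnsembleAverages_nonempty (f : DensityMatrix n → ℝ) (ρ : DensityMatrix n) :
    (pureEnsembleAverages f ρ).Nonempty := by
  have hn : Nonempty n := by
    by_contra h
    rw [not_nonempty_iff] at h
    simpa [Matrix.trace] using ρ.2.2
  obtain ⟨i⟩ := hn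
  let ψ : UnitVector n := ⟨Pi.single i 1, by simp⟩
  obtain ⟨_, q, _, φ, -, hq, -, hq1, -, hρ, -⟩ :=
    exists_ensemble_near (ρ := pureState ψ) (σ := ρ) (p := fun _ : Fin 1 => 1) (ψ := fun _ => ψ)
      (fun _ => zero_le_one) (by simp) (by simp)
  exact ⟨_, mem_pureEnsembleAverages f hq hq1 hρ⟩

end Ensembles

/-! ### Affine modulus of continuity and its passage to the roof. -/

section Roof

/-- `h δ` is the supremum of `|O|` on `(0, δ]`. Beyond `δ₀` this set may be unbounded, and `sSup`
then takes the value `0`; hence the restriction `δ ≤ δ₀`. -/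
lemma exists_modulus {O : ℝ → ℝ} (hO : Tendsto O (𝓝[>] 0) (𝓝 0)) :
    ∃ (δ₀ : ℝ) (h : ℝ → ℝ), 0 < δ₀ ∧ (∀ δ, 0 ≤ h δ) ∧ Tendsto h (𝓝[>] 0) (𝓝 0) ∧
      ∀ δ, δ ≤ δ₀ → ∀ t, 0 < t → t ≤ δ → |O t| ≤ h δ := by
  have key : ∀ ε > 0, ∃ δ > 0, ∀ t, 0 < t → t ≤ δ → |O t| ≤ ε := by
    intro ε hε
    have h1 : ∀ᶠ t in 𝓝[>] (0 : ℝ), |O t| < ε := by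
      have := hO.eventually (Metric.ball_mem_nhds 0 hε)
      simpa using this
    obtain ⟨u, hu, hu'⟩ := mem_nhdsGT_iff_exists_Ioc_subset.1 h1
    exact ⟨u, hu, fun t ht htu => (hu' ⟨ht, htu⟩ : |O t| < ε).le⟩
  obtain ⟨δ₀, hδ₀, hb⟩ := key 1 one_pos
  refine ⟨δ₀, fun δ => sSup ((fun t => |O t|) '' Set.Ioc 0 δ), hδ₀, ?_, ?_, ?_⟩
  · intro δ
    apply Real.sSup_nonneg
    rintro _ ⟨t, -, rfl⟩
    exact abs_nonneg _
  · rw [Metric.tendsto_nhds]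
    intro ε hε
    obtain ⟨δ, hδ, hδ'⟩ := key (ε / 2) (half_pos hε)
    filter_upwards [Ioc_mem_nhdsGT hδ] with x hx
    have h0 : 0 ≤ sSup ((fun t => |O t|) '' Set.Ioc 0 x) := by
      apply Real.sSup_nonneg
      rintro _ ⟨t, -, rfl⟩
      exact abs_nonneg _
    have h1 : sSup ((fun t => |O t|) '' Set.Ioc 0 x) ≤ ε / 2 := by
      apply Real.sSup_le _ (half_pos hε).le
      rintro _ ⟨t, ht, rfl⟩
      exact hδ' t ht.1 (ht.2.trans hx.2)
    rw [Real.dist_eq, sub_zero, abs_of_nonneg h0]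
    linarith
  · intro δ hδ t ht htδ
    refine le_csSup ⟨1, ?_⟩ ⟨t, ⟨ht, htδ⟩, rfl⟩
    rintro _ ⟨u, hu, rfl⟩
    exact hb u hu.1 (hu.2.trans hδ)

variable {n : Type*} [Fintype n]

/-- The mixture `(1 - t) ρ + t σ`. -/
def DensityMatrix.mix (ρ σ : DensityMatrix n) (t : Set.Icc (0 : ℝ) 1) : DensityMatrix n :=
  ⟨((1 - t.1 : ℝ) : ℂ) • ρ.1 + ((t.1 : ℝ) : ℂ) • σ.1,
    (ρ.2.1.smul (by exact_mod_cast sub_nonneg.2 t.2.2)).add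
      (σ.2.1.smul (by exact_mod_cast t.2.1)), by
    rw [Matrix.trace_add, Matrix.trace_smul, Matrix.trace_smul, ρ.2.2, σ.2.2]
    simp⟩

variable [DecidableEq n]

lemma traceDist_nonneg (ρ σ : DensityMatrix n) : 0 ≤ traceDist ρ σ := traceNorm_nonneg _

lemma traceDist_comm (ρ σ : DensityMatrix n) : traceDist ρ σ = traceDist σ ρ := by
  rw [traceDist, ← traceNorm_neg, neg_sub, traceDist]

lemma eq_of_traceDist_eq_zero {ρ σ : DensityMatrix n} (h : traceDist ρ σ = 0) : ρ = σ :=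
  Subtype.ext (sub_eq_zero.1 (eq_zero_of_traceNorm_eq_zero h))

lemma traceDist_mix (ρ σ : DensityMatrix n) {s t : Set.Icc (0 : ℝ) 1} (h : s ≤ t) :
    traceDist (ρ.mix σ s) (ρ.mix σ t) = (t.1 - s.1) * traceDist ρ σ := by
  have h' : 0 ≤ t.1 - s.1 := sub_nonneg.2 h
  rw [traceDist, traceDist, ← traceNorm_smul h']
  congr 1
  simp only [DensityMatrix.mix, Complex.ofReal_sub, Complex.ofReal_one]
  module

lemma traceDist_pureState_le_four (ψ φ : UnitVector n) :
    traceDist (pureState ψ) (pureState φ) ≤ 4 := by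
  have h1 := traceDist_pureState_le ψ φ
  have h2 := norm_sub_le (WithLp.toLp 2 ψ.1 : EuclideanSpace ℂ n) (WithLp.toLp 2 φ.1)
  rw [ψ.norm_eq_one, φ.norm_eq_one, ← WithLp.toLp_sub] at h2
  linarith

/-- Subdividing the segment from `ρ` to `σ` linearizes the modulus of continuity. -/
lemma abs_sub_le_of_small_steps {f : DensityMatrix n → ℝ} {C δ h : ℝ} {O : ℝ → ℝ}
    (hf : ∀ ρ σ, |f ρ - f σ| ≤ C * traceDist ρ σ + O (traceDist ρ σ)) (hC : 0 ≤ C) (hδ : 0 < δ)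
    (hh : 0 ≤ h) (hO : ∀ t, 0 < t → t ≤ δ → |O t| ≤ h) (ρ σ : DensityMatrix n) :
    |f ρ - f σ| ≤ C * traceDist ρ σ + (traceDist ρ σ / δ + 1) * h := by
  have hε0 := traceDist_nonneg ρ σ
  -- Nothing is known about `O 0`, so equal states are treated apart.
  rcases hε0.eq_or_lt with h0 | hpos
  · rw [eq_of_traceDist_eq_zero h0.symm, sub_self, abs_zero]
    have := traceDist_nonneg σ σ
    positivity
  set ε := traceDist ρ σ with hε
  let N := ⌈ε / δ⌉₊
  have hN : 0 < N := Nat.ceil_pos.2 (div_pos hpos hδ)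
  have hN' : (0 : ℝ) < N := by exact_mod_cast hN
  have hN1 : (N : ℝ) ≤ ε / δ + 1 := (Nat.ceil_lt_add_one (div_pos hpos hδ).le).le
  have hN2 : ε / N ≤ δ := by
    rw [div_le_iff₀ hN', mul_comm, ← div_le_iff₀ hδ]
    exact Nat.le_ceil _
  let t : ℕ → Set.Icc (0 : ℝ) 1 := fun j => Set.projIcc 0 1 zero_le_one (j / N)
  have ht : ∀ j ≤ N, (t j : ℝ) = j / N := by
    intro j hj
    have : (j : ℝ) / N ∈ Set.Icc (0 : ℝ) 1 :=
      ⟨by positivity, (div_le_one hN').2 (by exact_mod_cast hj)⟩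
    simp only [t, Set.projIcc_of_mem zero_le_one this]
  have hstep : ∀ {k}, k < N →
      dist (f (ρ.mix σ (t k))) (f (ρ.mix σ (t (k + 1)))) ≤ C * (ε / N) + h := by
    intro k hk
    have hle : t k ≤ t (k + 1) := by
      rw [← Subtype.coe_le_coe, ht k hk.le, ht (k + 1) hk]
      push_cast
      gcongr
      linarith
    have hd : traceDist (ρ.mix σ (t k)) (ρ.mix σ (t (k + 1))) = ε / N := by
      rw [traceDist_mix ρ σ hle, ht k hk.le, ht (k + 1) hk, ← hε]
      push_cast
      ring
    have h1 := hf (ρ.mix σ (t k)) (ρ.mix σ (t (k + 1)))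
    rw [hd] at h1
    rw [Real.dist_eq]
    linarith [le_abs_self (O (ε / N)), hO _ (div_pos hpos hN') hN2]
  have hsum := dist_le_range_sum_of_dist_le (f := fun k => f (ρ.mix σ (t k))) N hstep
  have e0 : ρ.mix σ (t 0) = ρ := by
    apply Subtype.ext
    simp [DensityMatrix.mix, ht 0 (Nat.zero_le _)]
  have e1 : ρ.mix σ (t N) = σ := by
    apply Subtype.ext
    simp [DensityMatrix.mix, ht N le_rfl, div_self hN'.ne']
  rw [e0, e1, Real.dist_eq, Finset.sum_const, Finset.card_range, nsmul_eq_mul] at hsum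
  refine hsum.trans ?_
  rw [mul_add, show (N : ℝ) * (C * (ε / N)) = C * ε by field_simp]
  exact add_le_add le_rfl (mul_le_mul_of_nonneg_right hN1 hh)

lemma abs_sub_pureState_le {f : DensityMatrix n → ℝ} {C δ h : ℝ} (hC : 0 ≤ C) (hδ : 0 < δ)
    (hh : 0 ≤ h) (hf : ∀ ρ σ, |f ρ - f σ| ≤ C * traceDist ρ σ + (traceDist ρ σ / δ + 1) * h)
    (ψ φ : UnitVector n) :
    |f (pureState ψ) - f (pureState φ)| ≤ C * 4 + (4 / δ + 1) * h := by
  have h4 := traceDist_pureState_le_four ψ φ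
  refine (hf _ _).trans ?_
  gcongr

omit [DecidableEq n] in
lemma bddBelow_pureEnsembleAverages {f : DensityMatrix n → ℝ} {B : ℝ}
    (hf : ∀ ψ φ, |f (pureState ψ) - f (pureState φ)| ≤ B) (ρ : DensityMatrix n) :
    BddBelow (pureEnsembleAverages f ρ) := by
  rcases isEmpty_or_nonempty (UnitVector n) with hE | ⟨⟨ψ₀⟩⟩
  · refine ⟨0, ?_⟩
    rintro _ ⟨m, p, ψ, -, -, -, rfl⟩
    exact Finset.sum_nonneg fun k _ => hE.elim (ψ k)
  · refine ⟨f (pureState ψ₀) - B, ?_⟩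
    rintro _ ⟨m, p, ψ, hp, hp1, -, rfl⟩
    calc f (pureState ψ₀) - B = ∑ k, p k * (f (pureState ψ₀) - B) := by
          rw [← Finset.sum_mul, hp1, one_mul]
      _ ≤ ∑ k, p k * f (pureState (ψ k)) := by
          refine Finset.sum_le_sum fun k _ => mul_le_mul_of_nonneg_left ?_ (hp k)
          linarith [le_abs_self (f (pureState ψ₀) - f (pureState (ψ k))), hf ψ₀ (ψ k)]

lemma isGLB_pureConvexRoof {f : DensityMatrix n → ℝ} {B : ℝ}
    (hf : ∀ ψ φ, |f (pureState ψ) - f (pureState φ)| ≤ B) (ρ : DensityMatrix n) :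
    IsGLB (pureEnsembleAverages f ρ) (pureConvexRoof f ρ) :=
  isGLB_csInf (pureEnsembleAverages_nonempty f ρ) (bddBelow_pureEnsembleAverages hf ρ)

/-- A function with affine modulus of continuity and bounded oscillation on pure states has a pure
convex roof whose increments are controlled by the square root of the trace distance. -/
lemma pureConvexRoof_sub_le {f : DensityMatrix n → ℝ} {C δ h B : ℝ} (hC : 0 ≤ C) (hδ : 0 < δ)
    (hh : 0 ≤ h) (hf : ∀ ρ σ, |f ρ - f σ| ≤ C * traceDist ρ σ + (traceDist ρ σ / δ + 1) * h)
    (hB : ∀ ψ φ, |f (pureState ψ) - f (pureState φ)| ≤ B) (ρ σ : DensityMatrix n) :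
    pureConvexRoof f σ - pureConvexRoof f ρ ≤
      C * (4 * √(traceDist ρ σ)) + (4 * √(traceDist ρ σ) / δ + 1) * h +
        2 * √(traceDist ρ σ) * B := by
  rw [sub_le_comm]
  refine (isGLB_pureConvexRoof hB ρ).2 ?_
  rintro _ ⟨m, p, ψ, hp, hp1, hρ, rfl⟩
  obtain ⟨p', q, ψ', φ, hp', hq, hp'1, hq1, hg, hσ, hE, hD⟩ :=
    exists_ensemble_near (σ := σ) hp hp1 hρ
  have hle := (isGLB_pureConvexRoof hB σ).1 (mem_pureEnsembleAverages f hq hq1 hσ)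
  rw [← hg fun ψ => f (pureState ψ)]
  have hκ : Nonempty (Fin m ⊕ n) := by
    by_contra hκ
    rw [not_nonempty_iff] at hκ
    simp at hq1
  obtain ⟨k₀⟩ := hκ
  have hB0 : 0 ≤ B := (abs_nonneg _).trans (hB (φ k₀) (φ k₀))
  -- Both weights sum to one, so subtracting the constant `f (pureState (φ k₀))` is free: only the
  -- oscillation of `f` enters, not its size.
  have hsplit : ∑ k, q k * f (pureState (φ k)) = ∑ k, p' k * f (pureState (ψ' k)) +
      ∑ k, p' k * (f (pureState (φ k)) - f (pureState (ψ' k))) +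
      ∑ k, (q k - p' k) * (f (pureState (φ k)) - f (pureState (φ k₀))) := by
    have h0 : ∑ k, (q k - p' k) * f (pureState (φ k₀)) = 0 := by
      rw [← Finset.sum_mul, Finset.sum_sub_distrib, hp'1, hq1, sub_self, zero_mul]
    rw [← add_zero (∑ k, p' k * f (pureState (ψ' k)) + _ + _), ← h0, ← Finset.sum_add_distrib,
      ← Finset.sum_add_distrib, ← Finset.sum_add_distrib]
    exact Finset.sum_congr rfl fun k _ => by ring
  have h1 : ∑ k, p' k * (f (pureState (φ k)) - f (pureState (ψ' k))) ≤
      C * (4 * √(traceDist ρ σ)) + (4 * √(traceDist ρ σ) / δ + 1) * h := by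
    have e : ∑ k, p' k * (C * traceDist (pureState (ψ' k)) (pureState (φ k)) +
        (traceDist (pureState (ψ' k)) (pureState (φ k)) / δ + 1) * h) =
        C * (∑ k, p' k * traceDist (pureState (ψ' k)) (pureState (φ k))) +
        ((∑ k, p' k * traceDist (pureState (ψ' k)) (pureState (φ k))) / δ + ∑ k, p' k) * h := by
      rw [Finset.sum_div, ← Finset.sum_add_distrib, Finset.sum_mul, Finset.mul_sum,
        ← Finset.sum_add_distrib]
      exact Finset.sum_congr rfl fun k _ => by ring
    calc _ ≤ ∑ k, p' k * (C * traceDist (pureState (ψ' k)) (pureState (φ k)) +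
        (traceDist (pureState (ψ' k)) (pureState (φ k)) / δ + 1) * h) := by
          refine Finset.sum_le_sum fun k _ => mul_le_mul_of_nonneg_left ?_ (hp' k)
          rw [traceDist_comm]
          exact (le_abs_self _).trans (hf _ _)
      _ ≤ _ := by
          rw [e, hp'1]
          gcongr
  have h2 : ∑ k, (q k - p' k) * (f (pureState (φ k)) - f (pureState (φ k₀))) ≤
      2 * √(traceDist ρ σ) * B := by
    refine le_trans (Finset.sum_le_sum fun k _ => ?_)
      ((Finset.sum_mul _ _ B).symm.le.trans (mul_le_mul_of_nonneg_right hD hB0))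
    refine (le_abs_self _).trans ?_
    rw [abs_mul]
    exact mul_le_mul_of_nonneg_left (hB _ _) (abs_nonneg _)
  linarith

end Roof

/-! ### Choice of scale and uniform constants. -/

theorem mainTheorem4 {ι : Type*} {X : ι → Type*} [∀ i, Fintype (X i)] [∀ i, DecidableEq (X i)]
    (f : ∀ i, DensityMatrix (X i) → ℝ) (hsub : Subextensive f)
    (hac : AsymptoticallyContinuous f) :
    (∀ (i : ι) (ρ : DensityMatrix (X i)),
      IsGLB (pureEnsembleAverages (f i) ρ) (pureConvexRoof (f i) ρ)) ∧
    ∃ (K : ℝ) (O : ℝ → ℝ), Tendsto O (𝓝[>] 0) (𝓝 0) ∧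
      ∀ (i : ι) (ρ σ : DensityMatrix (X i)),
        |pureConvexRoof (f i) ρ - pureConvexRoof (f i) σ| ≤
          K * √(2 * traceDist ρ σ) * Real.logb 2 (Fintype.card (X i)) +
            O (√(2 * traceDist ρ σ)) := by
  obtain ⟨K, O, hO, hf⟩ := hac
  obtain ⟨δ₀, h, hδ₀, hh, hlim, hOh⟩ := exists_modulus hO
  have hL : ∀ i, 0 ≤ Real.logb 2 (Fintype.card (X i)) := fun i => by
    rcases Nat.eq_zero_or_pos (Fintype.card (X i)) with h0 | h0
    · simp [h0]
    · exact Real.logb_nonneg one_lt_two (by exact_mod_cast h0)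
  have hC : ∀ i, 0 ≤ |K| * Real.logb 2 (Fintype.card (X i)) := fun i =>
    mul_nonneg (abs_nonneg K) (hL i)
  have hf' : ∀ i, ∀ ρ σ : DensityMatrix (X i), |f i ρ - f i σ| ≤
      |K| * Real.logb 2 (Fintype.card (X i)) * traceDist ρ σ + O (traceDist ρ σ) := by
    intro i ρ σ
    refine (hf i ρ σ).trans ?_
    rw [mul_right_comm]
    have := traceDist_nonneg ρ σ
    have := hL i
    gcongr
    exact le_abs_self K
  have hstep : ∀ δ, 0 < δ → δ ≤ δ₀ → ∀ i, ∀ ρ σ : DensityMatrix (X i), |f i ρ - f i σ| ≤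
      |K| * Real.logb 2 (Fintype.card (X i)) * traceDist ρ σ +
        (traceDist ρ σ / δ + 1) * h δ := fun δ hδ hδ' i =>
    abs_sub_le_of_small_steps (hf' i) (hC i) hδ (hh δ) (hOh δ hδ')
  have hB := fun i => abs_sub_pureState_le (hC i) hδ₀ (hh δ₀) (hstep δ₀ hδ₀ le_rfl i)
  -- `12 = 4 + 2 · 4`: transport of vectors, plus change of weights times the oscillation at the
  -- fixed scale `δ₀`. The step size is `δ = min x δ₀` with `x = √(2ε)`; for `x ≤ δ₀` the first
  -- error term is `5 h x`.
  refine ⟨fun i => isGLB_pureConvexRoof (hB i), 12 * |K|,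
    fun x => (4 * x / min x δ₀ + 1) * h (min x δ₀) + 2 * x * ((4 / δ₀ + 1) * h δ₀), ?_, ?_⟩
  · have hx : Tendsto (fun x : ℝ => x) (𝓝[>] 0) (𝓝 0) := nhdsWithin_le_nhds
    have h5 : Tendsto (fun x => 5 * h x + 2 * x * ((4 / δ₀ + 1) * h δ₀)) (𝓝[>] 0) (𝓝 0) := by
      simpa using (hlim.const_mul 5).add ((hx.const_mul 2).mul_const ((4 / δ₀ + 1) * h δ₀))
    refine h5.congr' ?_
    filter_upwards [Ioc_mem_nhdsGT hδ₀] with x hx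
    rw [min_eq_left hx.2, mul_div_assoc, div_self hx.1.ne']
    ring
  · intro i
    have one_side : ∀ ρ σ : DensityMatrix (X i),
        pureConvexRoof (f i) σ - pureConvexRoof (f i) ρ ≤
          12 * |K| * √(2 * traceDist ρ σ) * Real.logb 2 (Fintype.card (X i)) +
          ((4 * √(2 * traceDist ρ σ) / min (√(2 * traceDist ρ σ)) δ₀ + 1) *
            h (min (√(2 * traceDist ρ σ)) δ₀) +
            2 * √(2 * traceDist ρ σ) * ((4 / δ₀ + 1) * h δ₀)) := by
      intro ρ σ
      have hle : √(traceDist ρ σ) ≤ √(2 * traceDist ρ σ) :=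
        Real.sqrt_le_sqrt (by linarith [traceDist_nonneg ρ σ])
      rcases (traceDist_nonneg ρ σ).eq_or_lt with h0 | hpos
      -- Here `x = 0` is no admissible step size; nonnegativity of the right side suffices.
      · rw [eq_of_traceDist_eq_zero h0.symm, sub_self]
        have h1 := hh (min (√(2 * traceDist σ σ)) δ₀)
        have h2 := hh δ₀
        have h3 := hL i
        positivity
      · have hx : 0 < √(2 * traceDist ρ σ) := Real.sqrt_pos.2 (by positivity)
        generalize √(2 * traceDist ρ σ) = x at hx hle ⊢
        have hδ : 0 < min x δ₀ := lt_min hx hδ₀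
        refine (pureConvexRoof_sub_le (hC i) hδ (hh _) (hstep _ hδ (min_le_right _ _) i) (hB i)
          ρ σ).trans ?_
        have h1 := hh (min x δ₀)
        have h2 := hh δ₀
        have h3 := hC i
        calc _ ≤ |K| * Real.logb 2 (Fintype.card (X i)) * (4 * x) +
              (4 * x / min x δ₀ + 1) * h (min x δ₀) +
              2 * x * (|K| * Real.logb 2 (Fintype.card (X i)) * 4 + (4 / δ₀ + 1) * h δ₀) := by
                gcongr
          _ = _ := by ring
    intro ρ σ
    rw [abs_sub_le_iff]
    refine ⟨?_, one_side ρ σ⟩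
    rw [traceDist_comm]
    exact one_side σ ρ
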